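/- Let $n\ge 1$, let $d\mu$ denote Lebesgue measure on $\mathbb C^k$, and define the Fourier transform on the Schwartz space $\mathcal S(\mathbb C)$ by $\widetilde\psi(c)=\int_{\mathbb C}\psi(t)\,e^{i\operatorname{Re}(ct)}\,d\mu(t)$, extended to tempered distributions $T\in\mathcal S'(\mathbb C)$ by $\langle\widetilde T,\psi\rangle=\langle T,\widetilde\psi\rangle$. For $u\in\mathcal S'(\mathbb C)$ the generalized Radon transform of $f\in\mathcal S(\mathbb C^n)$ is the function on $\mathbb C^n$ $$(\mathcal R_uf)(a)=\int_{\mathbb C^n}f(x)\,u(x_n-a_1x_1-\dots-a_{n-1}x_{n-1}-a_n)\,d\mu(x),$$ that is, $(\mathcal R_uf)(a)=\langle u,g_a\rangle$, where $g_a\in\mathcal S(\mathbb C)$ is given by $$g_a(t)=\int_{\mathbb C^{n-1}}f\Bigl(y,\;t+\sum_{i<n}a_iy_i+a_n\Bigr)\,d\mu(y).$$ Theorem. Suppose that $\widetilde u$ is an ordinary function that is nonzero almost everywhere, i.e. there is a function $v:\mathbb C\to\mathbb C$ with $v\ne0$ almost everywhere such that for every $\psi\in\mathcal S(\mathbb C)$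 the function $v\psi$ is integrable and $\langle\widetilde u,\psi\rangle=\int v\psi\,d\mu$. Then $\mathcal R_u$ is invertible, i.e. injective on $\mathcal S(\mathbb C^n)$, and for every $f\in\mathcal S(\mathbb C^n)$, with $\varphi=\mathcal R_uf$, and every $x\in\mathbb C^n$, $$f(x)=(2\pi)^{-2n}\int_{\mathbb C^n}\varphi(a)\,U(x_n-a_1x_1-\dots-a_{n-1}x_{n-1}-a_n)\,d\mu(a),\qquad U(t)=\int_{\mathbb C}w(c)\,e^{i\operatorname{Re}(ct)}\,d\mu(c),\quad w(c)=v(c)^{-1}|c|^{2(n-1)} .$$ The integral is understood as follows. For $b=(a_1,\dots,a_{n-1})\in\mathbb C^{n-1}$ put $h_b(t)=\varphi\bigl(b,\;x_n-\sum_{i<n}b_ix_i-t\bigr)$. The generalized function $U$ acts on those functions $h$ whose (tempered) Fourier transform is a function $H$ with $wH$ integrable, by $\langle U,h\rangle=\int_{\mathbb C}w(c)H(c)\,d\mu(c)$. The assertion is that for every $b$ the pairing $\langle U,h_b\rangle$ is defined in this sense, that $b\mapsto\langle U,h_b\rangle$ is integrable on $\mathbb C^{n-1}$, and that $f(x)=(2\pi)^{-2n}\int_{\mathbb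 C^{n-1}}\langle U,h_b\rangle\,d\mu(b)$. Moreover, if $U$ is a tempered distribution, i.e. $U\in\mathcal S'(\mathbb C)$ with $w\widetilde\psi$ integrable and $\langle U,\psi\rangle=\int w\widetilde\psi\,d\mu$ for all $\psi\in\mathcal S(\mathbb C)$, and if $h_b\in\mathcal S(\mathbb C)$ for all $b$, then $b\mapsto\langle U,h_b\rangle$ is integrable and the same formula holds with $\langle U,h_b\rangle$ the ordinary distributional pairing. -/

import Mathlib

open MeasureTheory
open scoped SchwartzMap

noncomputable section

namespace RadonC

/-! ### Integrals of Schwartz functions over the fibres of a projection -/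

section Fibre

variable {V E : Type} [NormedAddCommGroup V] [NormedSpace ℝ V] [MeasurableSpace V] [BorelSpace V]
  [SecondCountableTopology V] [NormedAddCommGroup E] [NormedSpace ℝ E]

theorem fibre_bound (F : 𝓢(V × ℂ, E)) (k N : ℕ) :
    ∃ C : ℝ, ∀ x t, ‖t‖ ^ k * ‖F (x, t)‖ ≤ C * (1 + ‖x‖) ^ (-(N : ℝ)) := by
  refine ⟨2 ^ (k + N) * (Finset.Iic (k + N, 0)).sup (fun m => SchwartzMap.seminorm ℝ m.1 m.2) F,
    fun x t => ?_⟩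
  have h := SchwartzMap.one_add_le_sup_seminorm_apply (𝕜 := ℝ) (m := (k + N, 0)) (k := k + N)
    (n := 0) le_rfl le_rfl F (x, t)
  rw [norm_iteratedFDeriv_zero] at h
  have hx : (0 : ℝ) < 1 + ‖x‖ := by positivity
  rw [Real.rpow_neg hx.le, Real.rpow_natCast, ← div_eq_mul_inv, le_div_iff₀ (by positivity)]
  refine le_trans ?_ h
  have h1 : ‖x‖ ≤ ‖(x, t)‖ := norm_fst_le (x, t)
  have h2 : ‖t‖ ≤ 1 + ‖(x, t)‖ := (norm_snd_le (x, t)).trans (by linarith)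
  rw [pow_add]
  calc ‖t‖ ^ k * ‖F (x, t)‖ * (1 + ‖x‖) ^ N = ‖t‖ ^ k * (1 + ‖x‖) ^ N * ‖F (x, t)‖ := by ring
    _ ≤ _ := by gcongr

variable (μ : Measure V) [μ.HasTemperateGrowth]

theorem fibre_integrable (F : 𝓢(V × ℂ, E)) (t : ℂ) : Integrable (fun x => F (x, t)) μ := by
  obtain ⟨C, hC⟩ := fibre_bound F 0 μ.integrablePower
  refine ((Measure.integrable_pow_neg_integrablePower μ).const_mul C).mono' ?_ ?_
  · exact (F.continuous.comp (by fun_prop)).aestronglyMeasurable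
  · filter_upwards with x
    simpa using hC x t

/-- The derivative of a Schwartz function in the direction of the second factor. -/
def sndDeriv (F : 𝓢(V × ℂ, E)) : 𝓢(V × ℂ, ℂ →L[ℝ] E) :=
  SchwartzMap.postcompCLM ((ContinuousLinearMap.compL ℝ ℂ (V × ℂ) E).flip
    (ContinuousLinearMap.inr ℝ V ℂ)) (SchwartzMap.fderivCLM ℝ (V × ℂ) E F)

theorem fibre_hasFDerivAt (F : 𝓢(V × ℂ, E)) (t : ℂ) :
    HasFDerivAt (fun t => ∫ x, F (x, t) ∂μ) (∫ x, sndDeriv F (x, t) ∂μ) t := by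
  obtain ⟨C, hC⟩ := fibre_bound (sndDeriv F) 0 μ.integrablePower
  refine hasFDerivAt_integral_of_dominated_of_fderiv_le (𝕜 := ℝ) (s := Set.univ)
    (F := fun t x => F (x, t)) (F' := fun t x => sndDeriv F (x, t))
    (bound := fun x => C * (1 + ‖x‖) ^ (-(μ.integrablePower : ℝ))) Filter.univ_mem ?_ ?_ ?_ ?_ ?_ ?_
  · exact Filter.Eventually.of_forall fun s => (fibre_integrable μ F s).aestronglyMeasurable
  · exact fibre_integrable μ F t
  · exact (fibre_integrable μ (sndDeriv F) t).aestronglyMeasurable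
  · exact Filter.Eventually.of_forall fun x s _ => by simpa using hC x s
  · exact (Measure.integrable_pow_neg_integrablePower μ).const_mul C
  · refine Filter.Eventually.of_forall fun x s _ => ?_
    exact (F.differentiableAt (x := (x, s))).hasFDerivAt.comp s (hasFDerivAt_prodMk_right x s)

theorem fibre_contDiff (n : ℕ) : ∀ {E : Type} [NormedAddCommGroup E] [NormedSpace ℝ E]
    (F : 𝓢(V × ℂ, E)), ContDiff ℝ n (fun t => ∫ x, F (x, t) ∂μ) := by
  induction n with
  | zero =>
    intro E _ _ F
    exact contDiff_zero.2 (continuous_iff_continuousAt.2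
      fun t => (fibre_hasFDerivAt μ F t).continuousAt)
  | succ n ih =>
    intro E _ _ F
    exact contDiff_succ_iff_hasFDerivAt.2 ⟨_, ih (sndDeriv F), fibre_hasFDerivAt μ F⟩

theorem fibre_decay (k n : ℕ) : ∀ {E : Type} [NormedAddCommGroup E] [NormedSpace ℝ E]
    (F : 𝓢(V × ℂ, E)), ∃ C : ℝ, ∀ t : ℂ,
      ‖t‖ ^ k * ‖iteratedFDeriv ℝ n (fun t => ∫ x, F (x, t) ∂μ) t‖ ≤ C := by
  induction n with
  | zero =>
    intro E _ _ F
    obtain ⟨C, hC⟩ := fibre_bound F k μ.integrablePower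
    refine ⟨∫ x, C * (1 + ‖x‖) ^ (-(μ.integrablePower : ℝ)) ∂μ, fun t => ?_⟩
    rw [norm_iteratedFDeriv_zero]
    calc ‖t‖ ^ k * ‖∫ x, F (x, t) ∂μ‖ ≤ ‖t‖ ^ k * ∫ x, ‖F (x, t)‖ ∂μ := by
          gcongr
          exact norm_integral_le_integral_norm _
      _ = ∫ x, ‖t‖ ^ k * ‖F (x, t)‖ ∂μ := (integral_const_mul _ _).symm
      _ ≤ _ := integral_mono ((fibre_integrable μ F t).norm.const_mul _)
          ((Measure.integrable_pow_neg_integrablePower μ).const_mul C) fun x => hC x t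
  | succ n ih =>
    intro E _ _ F
    obtain ⟨C, hC⟩ := ih (sndDeriv F)
    refine ⟨C, fun t => ?_⟩
    rw [← norm_iteratedFDeriv_fderiv]
    have : fderiv ℝ (fun t => ∫ x, F (x, t) ∂μ) = fun t => ∫ x, sndDeriv F (x, t) ∂μ :=
      funext fun t => (fibre_hasFDerivAt μ F t).fderiv
    rw [this]
    exact hC t

end Fibre

/-! ### The generalized Radon transform -/

/-- The function `x_n - a_1 x_1 - ⋯ - a_{n-1} x_{n-1} - a_n` on `ℂⁿ × ℂⁿ`, where `n = m + 1`;
its zero set is the incidence relation between points and (non-vertical) hyperplanes. -/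
def incidence {m : ℕ} (x a : Fin (m + 1) → ℂ) : ℂ :=
  x (Fin.last m) - ∑ i : Fin m, a i.castSucc * x i.castSucc - a (Fin.last m)

/-- The point `x` with first `m` coordinates `y` and `incidence x a = t`. -/
def fibrePoint {m : ℕ} (a : Fin (m + 1) → ℂ) (y : Fin m → ℂ) (t : ℂ) : Fin (m + 1) → ℂ :=
  Fin.snoc (α := fun _ => ℂ) y (t + ∑ i : Fin m, a i.castSucc * y i + a (Fin.last m))

theorem incidence_fibrePoint {m : ℕ} (a : Fin (m + 1) → ℂ) (y : Fin m → ℂ) (t : ℂ) :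
    incidence (fibrePoint a y t) a = t := by
  simp [incidence, fibrePoint]
  ring

/-- The linear part of the affine isomorphism `(y, t) ↦ fibrePoint a y t`. -/
def fibreEquiv {m : ℕ} (a : Fin (m + 1) → ℂ) : ((Fin m → ℂ) × ℂ) ≃L[ℝ] (Fin (m + 1) → ℂ) :=
  LinearEquiv.toContinuousLinearEquiv
    { toFun := fun p => Fin.snoc (α := fun _ => ℂ) p.1 (p.2 + ∑ i : Fin m, a i.castSucc * p.1 i)
      invFun := fun x => (fun i => x i.castSucc,
        x (Fin.last m) - ∑ i : Fin m, a i.castSucc * x i.castSucc)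
      map_add' := fun p q => by
        ext j
        refine Fin.lastCases ?_ (fun i => ?_) j
        · simp [mul_add, Finset.sum_add_distrib]
          ring
        · simp
      map_smul' := fun r p => by
        ext j
        refine Fin.lastCases ?_ (fun i => ?_) j
        · simp [Finset.mul_sum, mul_left_comm]
        · simp
      left_inv := fun p => by simp
      right_inv := fun x => by
        ext j
        refine Fin.lastCases ?_ (fun i => ?_) j
        · simp
        · simp }

/-- The Schwartz function `(y, t) ↦ f (fibrePoint a y t)`. -/
def pullFibre {m : ℕ} (f : 𝓢(Fin (m + 1) → ℂ, ℂ)) (a : Fin (m + 1) → ℂ) :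
    𝓢((Fin m → ℂ) × ℂ, ℂ) :=
  SchwartzMap.compCLMOfContinuousLinearEquiv ℂ (fibreEquiv a)
    (SchwartzMap.compSubConstCLM ℂ
      (Fin.snoc (α := fun _ => ℂ) (0 : Fin m → ℂ) (-a (Fin.last m)) : Fin (m + 1) → ℂ) f)

theorem pullFibre_apply {m : ℕ} (f : 𝓢(Fin (m + 1) → ℂ, ℂ)) (a : Fin (m + 1) → ℂ)
    (y : Fin m → ℂ) (t : ℂ) : pullFibre f a (y, t) = f (fibrePoint a y t) := by
  have h : fibrePoint a y t = fibreEquiv a (y, t) -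
      (Fin.snoc (α := fun _ => ℂ) (0 : Fin m → ℂ) (-a (Fin.last m)) : Fin (m + 1) → ℂ) := by
    ext j
    refine Fin.lastCases ?_ (fun i => ?_) j
    · simp [fibrePoint, fibreEquiv]
    · simp [fibrePoint, fibreEquiv]
  rw [h]
  rfl

/-- The density of the push-forward of `f dμ` under `x ↦ incidence x a`: the integrals of `f` over
the hyperplanes `incidence x a = t`, as a Schwartz function of `t`. -/
def radonSlice {m : ℕ} (f : 𝓢(Fin (m + 1) → ℂ, ℂ)) (a : Fin (m + 1) → ℂ) : 𝓢(ℂ, ℂ) where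
  toFun t := ∫ y : Fin m → ℂ, f (fibrePoint a y t)
  smooth' := by
    simp_rw [← pullFibre_apply]
    exact contDiff_infty.2 fun n => fibre_contDiff volume n (pullFibre f a)
  decay' k n := by
    simp_rw [← pullFibre_apply]
    exact fibre_decay volume k n (pullFibre f a)

/-- The generalized Radon transform with kernel the generalized function `u`,
`(R_u f)(a) = ∫ f(x) u(x_n - a_1 x_1 - ⋯ - a_{n-1} x_{n-1} - a_n) dμ(x)`, `n = m + 1`.
The composition of `u` with the submersion `x ↦ incidence x a` is applied to `f`
by applying `u` to the push-forward of `f`. -/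
def genRadon {m : ℕ} (u : 𝓢'(ℂ, ℂ)) (f : 𝓢(Fin (m + 1) → ℂ, ℂ)) (a : Fin (m + 1) → ℂ) : ℂ :=
  u (radonSlice f a)

/-! ### The Fourier transform on `ℂ` -/

/-- The real-linear map `c ↦ -conj c / (2π)`. -/
def freqEquiv : ℂ ≃L[ℝ] ℂ :=
  Complex.conjCLE.trans (ContinuousLinearEquiv.smulLeft
    (Units.mk0 (-(2 * Real.pi)⁻¹ : ℝ) (neg_ne_zero.2 (inv_ne_zero Real.two_pi_pos.ne'))))

/-- The Fourier transform `ψ ↦ (c ↦ ∫ ψ(t) e^{i Re(ct)} dμ(t))` on Schwartz functions on `ℂ`,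
where `μ` is Lebesgue measure (see `fourierC_apply`). -/
def fourierC : 𝓢(ℂ, ℂ) →L[ℂ] 𝓢(ℂ, ℂ) :=
  (SchwartzMap.compCLMOfContinuousLinearEquiv ℂ freqEquiv).comp
    (SchwartzMap.fourierTransformCLM ℂ)

theorem fourierC_apply (ψ : 𝓢(ℂ, ℂ)) (c : ℂ) :
    fourierC ψ c = ∫ t : ℂ, ψ t * Complex.exp (Complex.I * ((c * t).re : ℂ)) := by
  change FourierTransform.fourier (ψ : ℂ → ℂ) (freqEquiv c) = _
  rw [Real.fourier_eq']
  refine integral_congr_ae (Filter.Eventually.of_forall fun t => ?_)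
  have hπ : (Real.pi : ℂ) ≠ 0 := by exact_mod_cast Real.pi_ne_zero
  have h : (-2 * Real.pi * inner ℝ t (freqEquiv c) : ℝ) = (c * t).re := by
    have : freqEquiv c = (-(2 * Real.pi)⁻¹ : ℝ) • (starRingEnd ℂ) c := rfl
    rw [this, inner_smul_right, Complex.inner]
    have := Real.pi_ne_zero
    simp
    field_simp
  simp only [h, smul_eq_mul]
  rw [mul_comm, mul_comm Complex.I]

/-- The Fourier transform of the generalized function `T` is the usual function `v`:
`⟨T, ψ̃⟩ = ∫ v ψ` for all test functions `ψ`. -/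
def HasFourierFunction (T : 𝓢'(ℂ, ℂ)) (v : ℂ → ℂ) : Prop :=
  ∀ ψ : 𝓢(ℂ, ℂ), Integrable (fun c => v c * ψ c) ∧ T (fourierC ψ) = ∫ c, v c * ψ c

/-- `H` is the Fourier transform of the function `h` in the sense of tempered generalized
functions. -/
def IsFourierOf (h H : ℂ → ℂ) : Prop :=
  ∀ ψ : 𝓢(ℂ, ℂ), Integrable (fun t => h t * fourierC ψ t) ∧ Integrable (fun c => H c * ψ c) ∧
    ∫ t, h t * fourierC ψ t = ∫ c, H c * ψ c

/-- The generalized function `U(t) = ∫ w(c) e^{i Re(ct)} dμ(c)`, when this integral makes sense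
as a tempered generalized function: `⟨U, ψ⟩ = ∫ w(c) ψ̃(c) dμ(c)`. -/
def IsFourierIntegral (w : ℂ → ℂ) (U : 𝓢'(ℂ, ℂ)) : Prop :=
  ∀ ψ : 𝓢(ℂ, ℂ), Integrable (fun c => w c * fourierC ψ c) ∧ U ψ = ∫ c, w c * fourierC ψ c

/-- `I = ∫ h(t) U(t) dμ(t)`, where `U(t) = ∫ w(c) e^{i Re(ct)} dμ(c)`, for an arbitrary function
`w` on `ℂ`. The generalized function `U` acts on the functions `h` whose Fourier transform is a
function `H` for which `w H` is integrable, and the value is `∫ w(c) H(c) dμ(c)`. -/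
def HasPairing (w h : ℂ → ℂ) (I : ℂ) : Prop :=
  ∃ H : ℂ → ℂ, IsFourierOf h H ∧ Integrable (fun c => w c * H c) ∧ I = ∫ c, w c * H c

theorem locallyIntegrable_of_schwartz {H : ℂ → ℂ}
    (hH : ∀ ψ : 𝓢(ℂ, ℂ), Integrable (fun c => H c * ψ c)) : LocallyIntegrable H := by
  intro x
  let g : ContDiffBump x := ⟨1, 2, one_pos, one_lt_two⟩
  have hg : HasCompactSupport (fun c => (g c : ℂ)) :=
    g.hasCompactSupport.comp_left (g := fun r : ℝ => (r : ℂ)) (by simp)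
  have hs : ContDiff ℝ ((⊤ : ℕ∞) : WithTop ℕ∞) (fun c => (g c : ℂ)) :=
    Complex.ofRealCLM.contDiff.comp g.contDiff
  refine ⟨Metric.closedBall x 1, Metric.closedBall_mem_nhds x one_pos, ?_⟩
  refine ((hH (hg.toSchwartzMap hs)).integrableOn (s := Metric.closedBall x 1)).congr_fun ?_
    measurableSet_closedBall
  intro c hc
  have : g c = 1 := g.one_of_mem_closedBall hc
  simp [this]

/-- The value in `HasPairing` does not depend on the choice of the representative `H`. -/
theorem HasPairing.unique {w h : ℂ → ℂ} {I J : ℂ} (hI : HasPairing w h I)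
    (hJ : HasPairing w h J) : I = J := by
  obtain ⟨H, hH, -, rfl⟩ := hI
  obtain ⟨K, hK, -, rfl⟩ := hJ
  have hHK : H =ᵐ[volume] K := by
    refine ae_eq_of_integral_contDiff_smul_eq
      (locallyIntegrable_of_schwartz fun ψ => (hH ψ).2.1)
      (locallyIntegrable_of_schwartz fun ψ => (hK ψ).2.1) fun g hg hgc => ?_
    have hgc' : HasCompactSupport (fun c => (g c : ℂ)) :=
      hgc.comp_left (g := fun r : ℝ => (r : ℂ)) (by simp)
    have hs : ContDiff ℝ ((⊤ : ℕ∞) : WithTop ℕ∞) (fun c => (g c : ℂ)) :=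
      Complex.ofRealCLM.contDiff.comp hg
    have h1 := (hH (hgc'.toSchwartzMap hs)).2.2
    have h2 := (hK (hgc'.toSchwartzMap hs)).2.2
    simpa [mul_comm] using h1.symm.trans h2
  refine integral_congr_ae ?_
  filter_upwards [hHK] with c hc
  simp [hc]

/-- The function `t ↦ φ(a)`, where `a = (b, a_n)` and `a_n` is determined by `incidence x a = t`. -/
def dualSlice {m : ℕ} (φ : (Fin (m + 1) → ℂ) → ℂ) (x : Fin (m + 1) → ℂ) (b : Fin m → ℂ) (t : ℂ) :
    ℂ :=
  φ (Fin.snoc (α := fun _ => ℂ) b (x (Fin.last m) - ∑ i : Fin m, b i * x i.castSucc - t))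

theorem incidence_dual {m : ℕ} (x : Fin (m + 1) → ℂ) (b : Fin m → ℂ) (t : ℂ) :
    incidence x (Fin.snoc (α := fun _ => ℂ) b
      (x (Fin.last m) - ∑ i : Fin m, b i * x i.castSucc - t)) = t := by
  simp [incidence]

/-- `J = ∫ φ(a) U(x_n - a_1 x_1 - ⋯ - a_{n-1} x_{n-1} - a_n) dμ(a)`, `n = m + 1`, where
`U(t) = ∫ w(c) e^{i Re(ct)} dμ(c)`: the generalized function `U` is applied in the variable `a_n`,
and the result is integrated over `b = (a_1, …, a_{n-1})`. -/
def HasDualIntegral {m : ℕ} (w : ℂ → ℂ) (φ : (Fin (m + 1) → ℂ) → ℂ) (x : Fin (m + 1) → ℂ)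
    (J : ℂ) : Prop :=
  ∃ I : (Fin m → ℂ) → ℂ, (∀ b, HasPairing w (dualSlice φ x b) (I b)) ∧ Integrable I ∧
    J = ∫ b, I b

theorem HasDualIntegral.unique {m : ℕ} {w : ℂ → ℂ} {φ : (Fin (m + 1) → ℂ) → ℂ}
    {x : Fin (m + 1) → ℂ} {J K : ℂ} (hJ : HasDualIntegral w φ x J)
    (hK : HasDualIntegral w φ x K) : J = K := by
  obtain ⟨I, hI, -, rfl⟩ := hJ
  obtain ⟨I', hI', -, rfl⟩ := hK
  exact congrArg _ (funext fun b => (hI b).unique (hI' b))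

end RadonC

end

/-! The proof is the projection-slice theorem followed by Fourier inversion, with n = m + 1. The
Fourier transform of `radonSlice f a` is, up to the phase carrying a_n, the Fourier transform F of f
restricted to the complex line spanned by (-a_1, …, -a_{n-1}, 1) (`fourierC_radonSlice`). Since u is
the inverse Fourier transform of v, the dual slice of R_u f at b has Fourier transform v(c) F(ξ)
e^{-i Re(ξ·x)} with ξ = (cb, -c) (`isFourierOf_dualSlice`, `fourierC_radonSlice_neg`).

Pairing with U multiplies this by v(c)⁻¹|c|^{2m}, so v cancels almost everywhere and only |c|^{2m}
F(ξ) e^{-i Re(ξ·x)} is left to integrate. The factor |c|^{2m} is exactly the real Jacobian of (b, c)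
↦ (cb, -c), so integrating over c and then b gives the Fourier inversion integral of F over ℂⁿ, that
is (2π)^{2n} f(x) (`integral_pow_norm_mul_comp_smul`, `integral_fourierPi_mul_exp`).

Injectivity follows because the dual integral depends on R_u f alone (`HasDualIntegral.unique`). -/

noncomputable section

namespace RadonC

/-! ### Fourier inversion on `ℂⁿ` -/

section Inversion

open scoped FourierTransform

/-- Fourier inversion on a Euclidean space, for the kernel `e^{i⟨ζ, x⟩}`. -/
theorem integral_fourier_smul_mul_exp {V : Type*} [NormedAddCommGroup V] [InnerProductSpace ℝ V]
    [FiniteDimensional ℝ V] [MeasurableSpace V] [BorelSpace V] (g : 𝓢(V, ℂ)) (x : V) :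
    ∫ ζ : V, 𝓕 (g : V → ℂ) (-(2 * Real.pi)⁻¹ • ζ) *
      Complex.exp (-(Complex.I * (inner ℝ ζ x : ℝ))) =
      (2 * Real.pi : ℂ) ^ Module.finrank ℝ V * g x := by
  have hπ := Real.pi_ne_zero
  have hg : 𝓕⁻ (𝓕 (g : V → ℂ)) = g :=
    g.continuous.fourierInv_fourier_eq g.integrable (𝓕 g : 𝓢(V, ℂ)).integrable
  have h := congrFun hg x
  rw [Real.fourierInv_eq'] at h
  rw [← h]
  have hs := Measure.integral_comp_smul (volume : Measure V)
    (fun ζ => Complex.exp (((2 * Real.pi * inner ℝ ζ x : ℝ) : ℂ) * Complex.I) • 𝓕 (g : V → ℂ) ζ)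
    (-(2 * Real.pi)⁻¹)
  -- The Jacobian of ζ ↦ -ζ/(2π) is the source of every power of 2π in the inversion formulas.
  have habs : |((-(2 * Real.pi)⁻¹) ^ Module.finrank ℝ V)⁻¹| =
      (2 * Real.pi) ^ Module.finrank ℝ V := by
    rw [abs_inv, abs_pow, abs_neg, abs_inv, inv_pow, inv_inv, abs_of_pos Real.two_pi_pos]
  rw [habs] at hs
  calc _ = _ := integral_congr_ae (Filter.Eventually.of_forall fun ζ => ?_)
    _ = _ := hs
    _ = _ := by rw [Complex.real_smul]; push_cast; rfl
  simp only [smul_eq_mul, inner_smul_left]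
  rw [mul_comm]
  congr 2
  have : (Real.pi : ℂ) ≠ 0 := by exact_mod_cast hπ
  simp
  field_simp

theorem finrank_piLp_complex (n : ℕ) :
    Module.finrank ℝ (PiLp 2 (fun _ : Fin n => ℂ)) = 2 * n := by
  rw [(PiLp.continuousLinearEquiv 2 ℝ (fun _ : Fin n => ℂ)).toLinearEquiv.finrank_eq,
    Module.finrank_pi_fintype]
  simp [mul_comm]

/-- Both measures are Haar, so they differ by a constant κ; the Gaussian integral equals π^n for
each, which forces κ = 1. This lets the Fourier theory of the inner product space serve `Fin n → ℂ`,
whose norm is the sup norm. -/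
theorem volume_preserving_toLp_complex (n : ℕ) :
    MeasurePreserving (WithLp.toLp 2 : (Fin n → ℂ) → PiLp 2 (fun _ : Fin n => ℂ)) := by
  let e := (PiLp.continuousLinearEquiv 2 ℝ (fun _ : Fin n => ℂ)).symm
  have he : ⇑e = WithLp.toLp 2 := rfl
  refine ⟨e.continuous.measurable, ?_⟩
  rw [← he]
  have : (Measure.map e volume).IsAddHaarMeasure := e.isAddHaarMeasure_map volume
  obtain ⟨κ, hκ⟩ : ∃ κ : NNReal, Measure.map e volume = κ • volume :=
    ⟨_, Measure.isAddLeftInvariant_eq_smul _ _⟩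
  have h1 : ∫ y : PiLp 2 (fun _ : Fin n => ℂ), Real.exp (-1 * ‖y‖ ^ 2) = Real.pi ^ n := by
    rw [GaussianFourier.integral_rexp_neg_mul_sq_norm one_pos, finrank_piLp_complex]
    simp
  have h2 : ∫ y, Real.exp (-1 * ‖y‖ ^ 2) ∂(Measure.map e volume) = Real.pi ^ n := by
    have hm : MeasurableEmbedding e := e.toHomeomorph.measurableEmbedding
    rw [hm.integral_map]
    have : ∀ x : Fin n → ℂ, Real.exp (-1 * ‖e x‖ ^ 2) = ∏ i, Real.exp (-1 * ‖x i‖ ^ 2) := by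
      intro x
      rw [← Real.exp_sum, PiLp.norm_sq_eq_of_L2, Finset.mul_sum]
      rfl
    simp_rw [this]
    rw [integral_fintype_prod_volume_eq_prod (fun (_ : Fin n) (z : ℂ) => Real.exp (-1 * ‖z‖ ^ 2)),
      GaussianFourier.integral_rexp_neg_mul_sq_norm one_pos]
    simp
  rw [hκ, integral_smul_nnreal_measure, h1] at h2
  have hκ1 : κ = 1 := by
    have := mul_right_cancel₀ (pow_ne_zero n Real.pi_ne_zero)
      ((show (κ : ℝ) * Real.pi ^ n = Real.pi ^ n from h2).trans (one_mul _).symm)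
    exact_mod_cast this
  rw [hκ, hκ1, one_smul]

/-- The real-linear map `ξ ↦ -conj ξ / (2π)` to the Euclidean space. -/
def freqEquivPi (n : ℕ) : (Fin n → ℂ) ≃L[ℝ] PiLp 2 (fun _ : Fin n => ℂ) :=
  (ContinuousLinearEquiv.piCongrRight fun _ : Fin n => freqEquiv).trans
    (PiLp.continuousLinearEquiv 2 ℝ (fun _ : Fin n => ℂ)).symm

/-- The Fourier transform `f ↦ (ξ ↦ ∫ f(x) e^{i Re(ξ·x)} dμ(x))` of a Schwartz function on `ℂⁿ`. -/
def fourierPi {n : ℕ} (f : 𝓢(Fin n → ℂ, ℂ)) : 𝓢(Fin n → ℂ, ℂ) :=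
  SchwartzMap.compCLMOfContinuousLinearEquiv ℂ (freqEquivPi n)
    (𝓕 (SchwartzMap.compCLMOfContinuousLinearEquiv ℂ
      (PiLp.continuousLinearEquiv 2 ℝ (fun _ : Fin n => ℂ)) f))

theorem inner_toLp_conj {n : ℕ} (ξ x : Fin n → ℂ) :
    inner ℝ (WithLp.toLp 2 (star ξ) : PiLp 2 (fun _ : Fin n => ℂ)) (WithLp.toLp 2 x) =
      (ξ ⬝ᵥ x).re := by
  simp [PiLp.inner_apply, Complex.inner, dotProduct, mul_comm]

theorem freqEquivPi_apply {n : ℕ} (ξ : Fin n → ℂ) :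
    freqEquivPi n ξ = -(2 * Real.pi)⁻¹ • WithLp.toLp 2 (star ξ) := by
  ext i
  rfl

theorem fourierPi_apply {n : ℕ} (f : 𝓢(Fin n → ℂ, ℂ)) (ξ : Fin n → ℂ) :
    fourierPi f ξ = ∫ x, f x * Complex.exp (Complex.I * ((ξ ⬝ᵥ x).re : ℂ)) := by
  change 𝓕 (fun y : PiLp 2 (fun _ : Fin n => ℂ) => f (WithLp.ofLp y)) (freqEquivPi n ξ) = _
  have hm : MeasurableEmbedding (WithLp.toLp 2 : (Fin n → ℂ) → PiLp 2 (fun _ : Fin n => ℂ)) :=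
    (PiLp.continuousLinearEquiv 2 ℝ (fun _ : Fin n => ℂ)).symm.toHomeomorph.measurableEmbedding
  rw [Real.fourier_eq', ← (volume_preserving_toLp_complex n).integral_comp hm]
  refine integral_congr_ae (Filter.Eventually.of_forall fun x => ?_)
  have h : (-2 * Real.pi * inner ℝ (WithLp.toLp 2 x) (freqEquivPi n ξ) : ℝ) = (ξ ⬝ᵥ x).re := by
    rw [freqEquivPi_apply, inner_smul_right, real_inner_comm, inner_toLp_conj]
    have := Real.pi_ne_zero
    field_simp
  simp only [h, smul_eq_mul]
  rw [mul_comm, mul_comm Complex.I]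

/-- Euclidean inversion, after the measure-preserving substitution of conj ξ for ξ, which turns the
real inner product into Re(ξ·x). The exponent 2n is the real dimension of ℂⁿ. -/
theorem integral_fourierPi_mul_exp {n : ℕ} (f : 𝓢(Fin n → ℂ, ℂ)) (x : Fin n → ℂ) :
    ∫ ξ, fourierPi f ξ * Complex.exp (-(Complex.I * ((ξ ⬝ᵥ x).re : ℂ))) =
      (2 * Real.pi : ℂ) ^ (2 * n) * f x := by
  have hm : MeasurableEmbedding (WithLp.toLp 2 : (Fin n → ℂ) → PiLp 2 (fun _ : Fin n => ℂ)) :=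
    (PiLp.continuousLinearEquiv 2 ℝ (fun _ : Fin n => ℂ)).symm.toHomeomorph.measurableEmbedding
  have hc : MeasurePreserving (star : (Fin n → ℂ) → (Fin n → ℂ)) :=
    volume_preserving_pi fun _ => Complex.conjLIE.measurePreserving
  have hcm : MeasurableEmbedding (star : (Fin n → ℂ) → (Fin n → ℂ)) :=
    (Homeomorph.mk (Equiv.mk star star star_star star_star)
      continuous_star continuous_star).measurableEmbedding
  have h := integral_fourier_smul_mul_exp (SchwartzMap.compCLMOfContinuousLinearEquiv ℂ
      (PiLp.continuousLinearEquiv 2 ℝ (fun _ : Fin n => ℂ)) f) (WithLp.toLp 2 x)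
  rw [finrank_piLp_complex, ← (volume_preserving_toLp_complex n).integral_comp hm,
    ← hc.integral_comp hcm] at h
  simp only [inner_toLp_conj] at h
  exact h

theorem integral_fourierC_mul_exp (ψ : 𝓢(ℂ, ℂ)) (t : ℂ) :
    ∫ c, fourierC ψ c * Complex.exp (-(Complex.I * ((c * t).re : ℂ))) =
      (2 * Real.pi : ℂ) ^ 2 * ψ t := by
  have hc : MeasurePreserving Complex.conjLIE := Complex.conjLIE.measurePreserving
  have h := integral_fourier_smul_mul_exp ψ t
  rw [Complex.finrank_real_complex,
    ← hc.integral_comp Complex.conjLIE.toHomeomorph.measurableEmbedding] at h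
  have hi : ∀ c : ℂ, inner ℝ (Complex.conjLIE c) t = (c * t).re := fun c => by
    simp [Complex.inner, mul_comm]
  simp only [hi] at h
  exact h

theorem fourierC_fourierC (ψ : 𝓢(ℂ, ℂ)) (c : ℂ) :
    fourierC (fourierC ψ) c = (2 * Real.pi : ℂ) ^ 2 * ψ (-c) := by
  rw [fourierC_apply, ← integral_fourierC_mul_exp]
  refine integral_congr_ae (Filter.Eventually.of_forall fun t => ?_)
  simp only [mul_neg, Complex.neg_re, Complex.ofReal_neg, neg_neg, mul_comm c t]

end Inversion

/-! ### Complex scaling -/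

/-- The real determinant of a complex-linear map is the squared modulus of its complex determinant,
here c^m. This is where the weight |c|^{2(n-1)} in U comes from. -/
theorem map_complex_smul_volume {m : ℕ} {c : ℂ} (hc : c ≠ 0) :
    Measure.map (fun b : Fin m → ℂ => c • b) volume =
      ENNReal.ofReal ((‖c‖ ^ (2 * m))⁻¹) • volume := by
  let L : (Fin m → ℂ) →ₗ[ℝ] (Fin m → ℂ) :=
    (c • (LinearMap.id : (Fin m → ℂ) →ₗ[ℂ] (Fin m → ℂ))).restrictScalars ℝ
  have hL : LinearMap.det L = ‖c‖ ^ (2 * m) := by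
    rw [LinearMap.det_restrictScalars, LinearMap.det_smul, Algebra.norm_complex_eq]
    simp [Complex.normSq_eq_norm_sq, ← pow_mul, mul_comm]
  have h0 : LinearMap.det L ≠ 0 := by
    rw [hL]
    exact pow_ne_zero _ (norm_ne_zero_iff.2 hc)
  have h := Measure.map_linearMap_addHaar_eq_smul_addHaar volume h0
  rw [hL, abs_of_nonneg (by positivity)] at h
  exact h

theorem integral_comp_complex_smul {m : ℕ} {E : Type*} [NormedAddCommGroup E] [NormedSpace ℝ E]
    {c : ℂ} (hc : c ≠ 0) (g : (Fin m → ℂ) → E) :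
    ‖c‖ ^ (2 * m) • ∫ b, g (c • b) = ∫ b, g b := by
  have hm : MeasurableEmbedding (fun b : Fin m → ℂ => c • b) :=
    (Homeomorph.smulOfNeZero c hc).measurableEmbedding
  rw [← hm.integral_map, map_complex_smul_volume hc, integral_smul_measure,
    ENNReal.toReal_ofReal (by positivity), smul_smul, mul_inv_cancel₀, one_smul]
  exact pow_ne_zero _ (norm_ne_zero_iff.2 hc)

theorem integrable_comp_complex_smul {m : ℕ} {E : Type*} [NormedAddCommGroup E]
    {c : ℂ} (hc : c ≠ 0) {g : (Fin m → ℂ) → E} (hg : Integrable g) :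
    Integrable (fun b => g (c • b)) := by
  have hm : MeasurableEmbedding (fun b : Fin m → ℂ => c • b) :=
    (Homeomorph.smulOfNeZero c hc).measurableEmbedding
  change Integrable (g ∘ fun b => c • b)
  rw [← hm.integrable_map_iff, map_complex_smul_volume hc]
  exact hg.smul_measure ENNReal.ofReal_ne_top

/-! ### The multiplication formula -/

theorem norm_exp_I_mul_ofReal (r : ℝ) : ‖Complex.exp (Complex.I * (r : ℂ))‖ = 1 := by
  rw [mul_comm, Complex.norm_exp_ofReal_mul_I]

theorem integrable_mul_mul_exp {k g : ℂ → ℂ} (hk : Integrable k) (hg : Integrable g) :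
    Integrable (fun p : ℂ × ℂ =>
      k p.1 * g p.2 * Complex.exp (Complex.I * ((p.1 * p.2).re : ℂ))) := by
  refine (hk.mul_prod hg).mul_bdd (c := 1) (Continuous.aestronglyMeasurable (by fun_prop)) ?_
  exact Filter.Eventually.of_forall fun p => (norm_exp_I_mul_ofReal _).le

/-- If `H` is integrable and `h` is its inverse Fourier transform, then `H` is the Fourier
transform of `h`. -/
theorem isFourierOf_of_eq_integral {h H : ℂ → ℂ} (hH : Integrable H)
    (hh : ∀ t, h t = ((2 * Real.pi : ℂ) ^ 2)⁻¹ *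
      ∫ c, H c * Complex.exp (-(Complex.I * ((c * t).re : ℂ)))) : IsFourierOf h H := by
  intro ψ
  have hπ : (2 * Real.pi : ℂ) ^ 2 ≠ 0 := by
    exact_mod_cast (pow_pos Real.two_pi_pos 2).ne'
  -- Reflecting c turns the inverse kernel into that of `fourierC`; after Fubini the inner integral
  -- is the double transform of ψ, equal to (2π)² ψ(-c).
  have hp := integrable_mul_mul_exp hH.comp_neg (fourierC ψ).integrable
  have hint : ∀ t, h t * fourierC ψ t = ((2 * Real.pi : ℂ) ^ 2)⁻¹ *
      ∫ c, H (-c) * fourierC ψ t * Complex.exp (Complex.I * ((c * t).re : ℂ)) := by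
    intro t
    rw [hh, mul_assoc, ← integral_mul_const, ← integral_neg_eq_self]
    congr 1
    refine integral_congr_ae (Filter.Eventually.of_forall fun c => ?_)
    simp only [neg_mul, Complex.neg_re, Complex.ofReal_neg, mul_neg, neg_neg]
    ring
  refine ⟨?_, ?_, ?_⟩
  · simp_rw [hint]
    exact hp.integral_prod_right.const_mul _
  · obtain ⟨C, hC⟩ := ψ.decay 0 0
    refine hH.mul_bdd (c := C) ψ.continuous.aestronglyMeasurable ?_
    exact Filter.Eventually.of_forall fun c => by simpa using hC.2 c
  · simp_rw [hint]
    rw [integral_const_mul, integral_integral_swap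
      (f := fun t c => H (-c) * fourierC ψ t * Complex.exp (Complex.I * ((c * t).re : ℂ))) hp.swap,
      ← integral_neg_eq_self,
      ← integral_const_mul]
    refine integral_congr_ae (Filter.Eventually.of_forall fun c => ?_)
    simp only [neg_neg, mul_assoc]
    rw [integral_const_mul, ← fourierC_apply, fourierC_fourierC]
    field_simp

/-- Makes the ordinary pairing of a tempered U with a Schwartz function an instance of `HasPairing`.
-/
theorem isFourierOf_schwartz (h : 𝓢(ℂ, ℂ)) : IsFourierOf h (fourierC h) := by
  refine isFourierOf_of_eq_integral (fourierC h).integrable fun t => ?_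
  have : (Real.pi : ℂ) ≠ 0 := by exact_mod_cast Real.pi_ne_zero
  rw [integral_fourierC_mul_exp]
  field_simp

/-- A tempered generalized function whose Fourier transform is a function `v` is the inverse Fourier
transform of `v`. -/
theorem HasFourierFunction.apply_eq {u : 𝓢'(ℂ, ℂ)} {v : ℂ → ℂ} (hv : HasFourierFunction u v)
    (ψ : 𝓢(ℂ, ℂ)) :
    Integrable (fun c => v c * fourierC ψ (-c)) ∧
      u ψ = ((2 * Real.pi : ℂ) ^ 2)⁻¹ * ∫ c, v c * fourierC ψ (-c) := by
  have hπ : (2 * Real.pi : ℂ) ^ 2 ≠ 0 := by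
    exact_mod_cast (pow_pos Real.two_pi_pos 2).ne'
  -- The reflected transform of ψ is chosen because its own transform is (2π)² ψ.
  let χ : 𝓢(ℂ, ℂ) :=
    SchwartzMap.compCLMOfContinuousLinearEquiv ℂ (ContinuousLinearEquiv.neg ℝ) (fourierC ψ)
  have hχ : ∀ c, χ c = fourierC ψ (-c) := fun c => rfl
  have h : fourierC χ = (2 * Real.pi : ℂ) ^ 2 • ψ := by
    ext t
    rw [smul_apply, smul_eq_mul, ← integral_fourierC_mul_exp, fourierC_apply,
      ← integral_neg_eq_self]
    simp only [hχ, neg_neg, mul_neg, neg_mul, Complex.neg_re, Complex.ofReal_neg, mul_comm t]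
  have h2 := hv χ
  rw [h, map_smul] at h2
  refine ⟨h2.1, ?_⟩
  rw [← show _ = ∫ c, v c * fourierC ψ (-c) from h2.2, smul_eq_mul, inv_mul_cancel_left₀ hπ]

/-! ### The Fourier transform of the slices -/

theorem volume_preserving_snoc (m : ℕ) :
    MeasurePreserving
      (fun p : (Fin m → ℂ) × ℂ => (Fin.snoc (α := fun _ => ℂ) p.1 p.2 : Fin (m + 1) → ℂ)) := by
  have h := ((volume_preserving_piFinSuccAbove (fun _ : Fin (m + 1) => ℂ) (Fin.last m)).symm
    _).comp (Measure.measurePreserving_swap (μ := (volume : Measure (Fin m → ℂ)))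
      (ν := (volume : Measure ℂ)))
  convert! h using 1
  ext p i
  simp [MeasurableEquiv.piFinSuccAbove, Fin.insertNthEquiv]

theorem measurableEmbedding_snoc (m : ℕ) :
    MeasurableEmbedding
      (fun p : (Fin m → ℂ) × ℂ => (Fin.snoc (α := fun _ => ℂ) p.1 p.2 : Fin (m + 1) → ℂ)) := by
  convert! (fibreEquiv (0 : Fin (m + 1) → ℂ)).toHomeomorph.measurableEmbedding using 2
  simp [fibreEquiv]

theorem snoc_dotProduct {m : ℕ} (b : Fin m → ℂ) (c : ℂ) (x : Fin (m + 1) → ℂ) :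
    (Fin.snoc (α := fun _ => ℂ) b c : Fin (m + 1) → ℂ) ⬝ᵥ x =
      ∑ i, b i * x i.castSucc + c * x (Fin.last m) := by
  simp [dotProduct, Fin.sum_univ_castSucc]

/-- The Fourier transform of a slice is the Fourier transform of `f` on a complex line. -/
theorem fourierC_radonSlice {m : ℕ} (f : 𝓢(Fin (m + 1) → ℂ, ℂ)) (a : Fin (m + 1) → ℂ) (c : ℂ) :
    fourierC (radonSlice f a) c = Complex.exp (-(Complex.I * ((c * a (Fin.last m)).re : ℂ))) *
      fourierPi f (Fin.snoc (α := fun _ => ℂ) (fun i : Fin m => -c * a i.castSucc) c) := by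
  have hp : Integrable (fun p : (Fin m → ℂ) × ℂ => f (fibrePoint a p.1 p.2) *
      Complex.exp (Complex.I * ((c * p.2).re : ℂ))) := by
    refine Integrable.mul_bdd (c := 1) ?_ (Continuous.aestronglyMeasurable (by fun_prop)) ?_
    · have : ((volume : Measure (Fin m → ℂ)).prod (volume : Measure ℂ)).IsAddHaarMeasure :=
        Measure.prod.instIsAddHaarMeasure _ _
      simpa only [← pullFibre_apply, Measure.volume_eq_prod] using
        (pullFibre f a).integrable (μ := (volume : Measure (Fin m → ℂ)).prod volume)
    · exact Filter.Eventually.of_forall fun p => (norm_exp_I_mul_ofReal _).le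
  set ξ : Fin (m + 1) → ℂ := Fin.snoc (α := fun _ => ℂ) (fun i : Fin m => -c * a i.castSucc) c
  have hq : Integrable (fun p : (Fin m → ℂ) × ℂ => f (Fin.snoc (α := fun _ => ℂ) p.1 p.2) *
      Complex.exp (Complex.I *
        ((ξ ⬝ᵥ (Fin.snoc (α := fun _ => ℂ) p.1 p.2 : Fin (m + 1) → ℂ)).re : ℂ))) := by
    have h : Integrable (fun x => f x * Complex.exp (Complex.I * ((ξ ⬝ᵥ x).re : ℂ))) := by
      refine f.integrable.mul_bdd (c := 1) (Continuous.aestronglyMeasurable (by fun_prop)) ?_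
      exact Filter.Eventually.of_forall fun p => (norm_exp_I_mul_ofReal _).le
    exact (volume_preserving_snoc m).integrable_comp_of_integrable h
  rw [fourierC_apply, fourierPi_apply, ← (volume_preserving_snoc m).integral_comp
    (measurableEmbedding_snoc m), Measure.volume_eq_prod, integral_prod _ hq,
    ← integral_const_mul]
  change ∫ t, (∫ y : Fin m → ℂ, f (fibrePoint a y t)) * _ = _
  simp_rw [← integral_mul_const]
  rw [integral_integral_swap (f := fun t y => f (fibrePoint a y t) *
    Complex.exp (Complex.I * ((c * t).re : ℂ))) hp.swap]
  refine integral_congr_ae (Filter.Eventually.of_forall fun y => ?_)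
  simp only
  -- For fixed y, translation in the last variable passes from the coordinate x_n to the incidence
  -- value t = x_n - ∑ a_i y_i - a_n.
  rw [← integral_const_mul, ← integral_add_right_eq_self (μ := (volume : Measure ℂ)) (fun t =>
    Complex.exp (-(Complex.I * ((c * a (Fin.last m)).re : ℂ))) *
      (f (Fin.snoc (α := fun _ => ℂ) y t) * Complex.exp (Complex.I *
        ((ξ ⬝ᵥ (Fin.snoc (α := fun _ => ℂ) y t : Fin (m + 1) → ℂ)).re : ℂ))))
    (∑ i : Fin m, a i.castSucc * y i + a (Fin.last m))]
  refine integral_congr_ae (Filter.Eventually.of_forall fun t => ?_)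
  simp only [fibrePoint, ← add_assoc]
  rw [mul_left_comm, ← Complex.exp_add]
  congr 2
  rw [← mul_neg, ← mul_add, ← Complex.ofReal_neg, ← Complex.ofReal_add, ← Complex.neg_re,
    ← Complex.add_re, snoc_dotProduct]
  simp only [Fin.snoc_castSucc, Fin.snoc_last, neg_mul, Finset.sum_neg_distrib, mul_assoc,
    ← Finset.mul_sum]
  congr 3
  ring

/-! ### Slicing by complex lines -/

/-- The change of variables `(b, c) ↦ (c b, -c)` on `ℂᵐ × ℂ`. -/
theorem integrable_pow_norm_mul_comp_smul {m : ℕ} {Ψ : (Fin m → ℂ) × ℂ → ℂ} (hΨ : Integrable Ψ)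
    (hc : Continuous Ψ) :
    Integrable (fun p : (Fin m → ℂ) × ℂ => (‖p.2‖ : ℂ) ^ (2 * m) * Ψ (p.2 • p.1, -p.2)) := by
  -- The substitution degenerates only at c = 0, a null set; for every other c, scaling b by c is
  -- invertible.
  have h0 : ∀ᵐ c : ℂ, c ≠ 0 := by simp [ae_iff]
  rw [Measure.volume_eq_prod] at hΨ ⊢
  have hneg : Integrable (fun c : ℂ => ∫ y : Fin m → ℂ, ‖Ψ (y, -c)‖) :=
    hΨ.norm.integral_prod_right.comp_neg
  have hsec : ∀ᵐ c : ℂ, Integrable (fun y => Ψ (y, -c)) :=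
    (Measure.measurePreserving_neg (volume : Measure ℂ)).quasiMeasurePreserving.ae hΨ.prod_left_ae
  refine (integrable_prod_iff' (Continuous.aestronglyMeasurable (by fun_prop))).2 ⟨?_, ?_⟩
  · filter_upwards [h0, hsec] with c hc0 hc1
    exact (integrable_comp_complex_smul hc0 hc1).const_mul _
  · refine hneg.congr ?_
    filter_upwards [h0] with c hc0
    rw [← integral_comp_complex_smul hc0, ← integral_smul]
    simp

/-- For fixed c ≠ 0 the weight is the Jacobian of b ↦ cb, and c ↦ -c preserves measure. Integrating
over c first, as the pairing with U requires, needs Fubini, hence the preceding integrability lemma.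
-/
theorem integral_pow_norm_mul_comp_smul {m : ℕ} {Ψ : (Fin m → ℂ) × ℂ → ℂ} (hΨ : Integrable Ψ)
    (hc : Continuous Ψ) :
    ∫ b, ∫ c, (‖c‖ : ℂ) ^ (2 * m) * Ψ (c • b, -c) = ∫ p, Ψ p := by
  have h0 : ∀ᵐ c : ℂ, c ≠ 0 := by simp [ae_iff]
  have h := integrable_pow_norm_mul_comp_smul hΨ hc
  rw [Measure.volume_eq_prod] at hΨ h ⊢
  rw [integral_integral_swap h, integral_prod_symm _ hΨ,
    ← integral_neg_eq_self (fun c => ∫ y, Ψ (y, c))]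
  refine integral_congr_ae ?_
  filter_upwards [h0] with c hc0
  rw [← integral_comp_complex_smul hc0 (fun y => Ψ (y, -c)), ← integral_smul]
  simp

/-! ### Inversion of the generalized Radon transform -/

/-- The Fourier transform of a dual slice of the generalized Radon transform. -/
theorem isFourierOf_dualSlice {m : ℕ} {u : 𝓢'(ℂ, ℂ)} {v : ℂ → ℂ} (hv : HasFourierFunction u v)
    (f : 𝓢(Fin (m + 1) → ℂ, ℂ)) (x : Fin (m + 1) → ℂ) (b : Fin m → ℂ) :
    IsFourierOf (dualSlice (genRadon u f) x b) (fun c => v c * fourierC (radonSlice f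
      (Fin.snoc (α := fun _ => ℂ) b (x (Fin.last m) - ∑ i : Fin m, b i * x i.castSucc))) (-c)) := by
  refine isFourierOf_of_eq_integral (hv.apply_eq _).1 fun t => ?_
  rw [dualSlice, genRadon, (hv.apply_eq _).2]
  congr 1
  refine integral_congr_ae (Filter.Eventually.of_forall fun c => ?_)
  -- Changing a_n only multiplies the transform of the slice by a character. With a_n = s - t, where
  -- s = x_n - ∑ b_i x_i, this character splits into e^{i Re(cs)} and the inverse Fourier kernel
  -- e^{-i Re(ct)}.
  simp only [fourierC_radonSlice, Fin.snoc_castSucc, Fin.snoc_last, mul_assoc]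
  congr 1
  rw [mul_comm _ (Complex.exp (-(Complex.I * ((c * t).re : ℂ)))), ← mul_assoc, ← Complex.exp_add]
  congr 2
  simp only [mul_sub, neg_mul, Complex.neg_re, Complex.sub_re, Complex.ofReal_neg,
    Complex.ofReal_sub]
  ring

/-- The value of the pairing of `U` with a dual slice. -/
theorem hasPairing_dualSlice {m : ℕ} {u : 𝓢'(ℂ, ℂ)} {v : ℂ → ℂ} (hv : HasFourierFunction u v)
    (hv0 : ∀ᵐ c : ℂ, v c ≠ 0) (f : 𝓢(Fin (m + 1) → ℂ, ℂ)) (x : Fin (m + 1) → ℂ) (b : Fin m → ℂ) :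
    HasPairing (fun c => (v c)⁻¹ * (‖c‖ : ℂ) ^ (2 * m)) (dualSlice (genRadon u f) x b)
      (∫ c, (‖c‖ : ℂ) ^ (2 * m) * fourierC (radonSlice f
        (Fin.snoc (α := fun _ => ℂ) b
          (x (Fin.last m) - ∑ i : Fin m, b i * x i.castSucc))) (-c)) := by
  set G := fourierC (radonSlice f (Fin.snoc (α := fun _ => ℂ) b
    (x (Fin.last m) - ∑ i : Fin m, b i * x i.castSucc)))
  -- After cancellation only a polynomial weight times a Schwartz function remains, so no bound on
  -- v⁻¹ is needed.
  have hG : Integrable (fun c => (‖c‖ : ℂ) ^ (2 * m) * G (-c)) := by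
    refine (((G.integrable_pow_mul volume (2 * m)).comp_neg).congr' ?_ ?_)
    · exact Continuous.aestronglyMeasurable (by fun_prop)
    · exact Filter.Eventually.of_forall fun c => by simp
  have hae : (fun c => (‖c‖ : ℂ) ^ (2 * m) * G (-c)) =ᵐ[volume]
      fun c => (v c)⁻¹ * (‖c‖ : ℂ) ^ (2 * m) * (v c * G (-c)) := by
    filter_upwards [hv0] with c hc
    field_simp
  exact ⟨_, isFourierOf_dualSlice hv f x b, hG.congr hae, integral_congr_ae hae⟩

/-- For ξ = (cb, -c) one has ξ·x = -c (x_n - ∑ b_i x_i), so the phase of the slice is exactly the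
inversion kernel at ξ. -/
theorem fourierC_radonSlice_neg {m : ℕ} (f : 𝓢(Fin (m + 1) → ℂ, ℂ)) (x : Fin (m + 1) → ℂ)
    (b : Fin m → ℂ) (c : ℂ) :
    fourierC (radonSlice f (Fin.snoc (α := fun _ => ℂ) b
      (x (Fin.last m) - ∑ i : Fin m, b i * x i.castSucc))) (-c) =
    fourierPi f (Fin.snoc (α := fun _ => ℂ) (c • b) (-c)) * Complex.exp (-(Complex.I *
      (((Fin.snoc (α := fun _ => ℂ) (c • b) (-c) : Fin (m + 1) → ℂ) ⬝ᵥ x).re : ℂ))) := by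
  rw [fourierC_radonSlice, snoc_dotProduct, mul_comm]
  simp only [Fin.snoc_castSucc, Fin.snoc_last, neg_neg, Pi.smul_apply, smul_eq_mul, mul_assoc,
    ← Finset.mul_sum]
  congr 1
  · congr 5
    ring

/-- The lines spanned by (b, -1) sweep out ℂⁿ up to the null set ξ_n = 0, so the pairings,
integrated over b, assemble the full Fourier inversion integral at x. -/
theorem hasDualIntegral_genRadon {m : ℕ} {u : 𝓢'(ℂ, ℂ)} {v : ℂ → ℂ} (hv : HasFourierFunction u v)
    (hv0 : ∀ᵐ c : ℂ, v c ≠ 0) (f : 𝓢(Fin (m + 1) → ℂ, ℂ)) (x : Fin (m + 1) → ℂ) :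
    HasDualIntegral (fun c => (v c)⁻¹ * (‖c‖ : ℂ) ^ (2 * m)) (genRadon u f) x
      ((2 * Real.pi : ℂ) ^ (2 * (m + 1)) * f x) := by
  have hΦ : Integrable (fun ξ => fourierPi f ξ *
      Complex.exp (-(Complex.I * ((ξ ⬝ᵥ x).re : ℂ)))) := by
    refine (fourierPi f).integrable.mul_bdd (c := 1)
      (Continuous.aestronglyMeasurable (by fun_prop)) ?_
    refine Filter.Eventually.of_forall fun ξ => ?_
    rw [← mul_neg, ← Complex.ofReal_neg]
    exact (norm_exp_I_mul_ofReal _).le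
  have hΨ := (volume_preserving_snoc m).integrable_comp_of_integrable hΦ
  have hc : Continuous ((fun ξ => fourierPi f ξ *
      Complex.exp (-(Complex.I * ((ξ ⬝ᵥ x).re : ℂ)))) ∘
      fun p : (Fin m → ℂ) × ℂ => (Fin.snoc (α := fun _ => ℂ) p.1 p.2 : Fin (m + 1) → ℂ)) := by
    fun_prop
  refine ⟨_, hasPairing_dualSlice hv hv0 f x, ?_, ?_⟩
  · simp_rw [fourierC_radonSlice_neg]
    exact (integrable_pow_norm_mul_comp_smul hΨ hc).integral_prod_left
  · simp_rw [fourierC_radonSlice_neg]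
    rw [← integral_fourierPi_mul_exp, ← (volume_preserving_snoc m).integral_comp
      (measurableEmbedding_snoc m)]
    exact (integral_pow_norm_mul_comp_smul hΨ hc).symm

end RadonC

end

/-! ### Injectivity and the inversion formula -/

theorem mainTheorem3 (m : ℕ) (u : 𝓢'(ℂ, ℂ)) (v : ℂ → ℂ)
    (hv : RadonC.HasFourierFunction u v) (hv0 : ∀ᵐ c : ℂ, v c ≠ 0) :
    Function.Injective
      (fun f : 𝓢(Fin (m + 1) → ℂ, ℂ) => (RadonC.genRadon u f : (Fin (m + 1) → ℂ) → ℂ)) ∧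
    (∀ (f : 𝓢(Fin (m + 1) → ℂ, ℂ)) (x : Fin (m + 1) → ℂ),
      RadonC.HasDualIntegral (fun c => (v c)⁻¹ * (‖c‖ : ℂ) ^ (2 * m)) (RadonC.genRadon u f) x
        ((2 * Real.pi : ℂ) ^ (2 * (m + 1)) * f x)) ∧
    (∀ U : 𝓢'(ℂ, ℂ), RadonC.IsFourierIntegral (fun c => (v c)⁻¹ * (‖c‖ : ℂ) ^ (2 * m)) U →
      ∀ (f : 𝓢(Fin (m + 1) → ℂ, ℂ)) (x : Fin (m + 1) → ℂ) (h : (Fin m → ℂ) → 𝓢(ℂ, ℂ)),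
        (∀ b t, h b t = RadonC.dualSlice (RadonC.genRadon u f) x b t) →
          Integrable (fun b => U (h b)) ∧
          f x = ((2 * Real.pi : ℂ) ^ (2 * (m + 1)))⁻¹ * ∫ b, U (h b)) := by
  have hπ : (2 * Real.pi : ℂ) ^ (2 * (m + 1)) ≠ 0 := by
    exact_mod_cast (pow_pos Real.two_pi_pos _).ne'
  refine ⟨fun f g hfg => ?_, RadonC.hasDualIntegral_genRadon hv hv0, fun U hU f x h hh => ?_⟩
  · ext x
    have hf := RadonC.hasDualIntegral_genRadon hv hv0 f x
    rw [show RadonC.genRadon u f = RadonC.genRadon u g from hfg] at hf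
    exact mul_left_cancel₀ hπ (hf.unique (RadonC.hasDualIntegral_genRadon hv hv0 g x))
  · obtain ⟨I, hI, hint, hIx⟩ := RadonC.hasDualIntegral_genRadon hv hv0 f x
    have hUI : (fun b => U (h b)) = I := by
      funext b
      -- U (h b) is also a value of the generalized pairing, so uniqueness identifies it with I b
      -- and the integrability of I carries over.
      have hp : RadonC.HasPairing (fun c => (v c)⁻¹ * (‖c‖ : ℂ) ^ (2 * m)) (h b) (U (h b)) :=
        ⟨_, RadonC.isFourierOf_schwartz (h b), hU (h b)⟩
      rw [show (h b : ℂ → ℂ) = _ from funext (hh b)] at hp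
      exact hp.unique (hI b)
    rw [hUI, ← hIx, inv_mul_cancel_left₀ hπ]
    exact ⟨hint, rfl⟩
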